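/- Let $(X,\mu)$ be a $\sigma$-finite complete measure space for which $L^2(X)$ is separable, and let $\mathcal H,\mathcal H'$ be separable complex Hilbert spaces. For $\phi\in L^\infty(X)$ let $M_\phi$ (resp. $M'_\phi$) be the operator of pointwise multiplication by $\phi$ on $L^2(X;\mathcal H)$ (resp. $L^2(X;\mathcal H')$). A closed subspace $V\subset L^2(X;\mathcal H)$ is called an MI space if $M_\phi V\subset V$ for all $\phi\in L^\infty(X)$, and a bounded linear operator $T\colon V\to V'$ between MI spaces $V\subset L^2(X;\mathcal H)$ and $V'\subset L^2(X;\mathcal H')$ is called an MI operator if $TM_\phi=M'_\phi T$ on $V$ for all $\phi\in L^\infty(X)$. A determining set is a set $\mathcal D\subset L^\infty(X)$ such that for all $f_1\neq f_2$ in $L^1(X)$ there is $g\in\mathcal D$ with $\int_X f_1\overline g\,d\mu\neq\int_X f_2\overline g\,d\mu$. A measurable $\mathcal H$-valued range function is a map $J$ from $X$ to the closed subspaces of $\mathcal H$ such that $x\mapsto\langle P_J(x)u,v\rangle$ is measurable for all $u,v\in\mathcal H$, where $P_J(x)$ is the orthogonal projection onto $J(x)$. Put $V_J=\{\varphi\in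 L^2(X;\mathcal H):\varphi(x)\in J(x)\text{ for a.e. }x\}$; this is an MI space. For measurable range functions $J$ ($\mathcal H$-valued) and $J'$ ($\mathcal H'$-valued), a bounded measurable range operator $R\colon J\to J'$ is a choice of linear operators $R(x)\colon J(x)\to J'(x)$, $x\in X$, with $\operatorname{ess\,sup}_{x}\|R(x)\|<\infty$ and such that $x\mapsto\langle R(x)P_J(x)u,v\rangle$ is measurable for all $u\in\mathcal H$, $v\in\mathcal H'$. It defines a bounded operator $\int_X^\oplus R(x)\,d\mu(x)\colon V_J\to V_{J'}$ by $\varphi\mapsto\bigl(x\mapsto R(x)[\varphi(x)]\bigr)$. **(A)** Let $J,J'$ be measurable range functions with values in the closed subspaces of $\mathcal H$ and $\mathcal H'$, respectively. For every bounded linear operator $T\colon V_J\to V_{J'}$ and every determining set $\mathcal D$, the following are equivalent: 1. $T$ is an MI operator; 2. $TM_\phi=M'_\phi T$ on $V_J$ for every $\phi\in\mathcal D$; 3. $T=\int_X^\oplus R(x)\,d\mu(x)$ for some bounded measurable range operator $R\colon J\to J'$. Moreover, $R\mapsto\int_X^\oplus R(x)\,d\mu(x)$ is a bijection from the bounded measurable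 range operators $J\to J'$, modulo equality a.e., onto the MI operators $V_J\to V_{J'}$. **(B)** Let $X\text{-}\mathbf{MI}$ be the category whose objects are the MI subspaces of $L^2(X;\mathcal K)$ for the various separable Hilbert spaces $\mathcal K$, with MI operators as morphisms. Let $X\text{-}\mathbf{Ran}$ be the category whose objects are the measurable $\mathcal K$-valued range functions modulo equality a.e., for the various separable Hilbert spaces $\mathcal K$, and whose morphisms are the bounded measurable range operators modulo equality a.e., composed pointwise. (In both categories the space $\mathcal K$ is part of the object.) Then the functor $F\colon X\text{-}\mathbf{Ran}\to X\text{-}\mathbf{MI}$ given by $F(J)=V_J$ and $F(R)=\int_X^\oplus R(x)\,d\mu(x)$ is an isomorphism of categories: there is a functor $G\colon X\text{-}\mathbf{MI}\to X\text{-}\mathbf{Ran}$ such that $GF$ and $FG$ are equal to the identity functors. -/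

import Mathlib

open MeasureTheory CategoryTheory Filter
open scoped ENNReal Topology

universe u v v' w

noncomputable section

namespace MultInv

/-! ### Multiplication operators, multiplication-invariant spaces and operators -/

section Mul

variable {X : Type u} [MeasurableSpace X] {μ : Measure X}
variable {H : Type v} [NormedAddCommGroup H] [InnerProductSpace ℂ H]
variable {H' : Type v'} [NormedAddCommGroup H'] [InnerProductSpace ℂ H']

/-- The multiplication operator `M_φ` on `L²(X; H)`, for `φ ∈ L^∞(X)`; the product `φ • f` is the
pointwise product `x ↦ φ x • f x`. -/
def mulOp (φ : Lp ℂ ∞ μ) : Lp H 2 μ →L[ℂ] Lp H 2 μ :=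
  LinearMap.mkContinuous
    { toFun := fun f => (φ • f : Lp H 2 μ)
      map_add' := fun f g => Lp.add_smul φ f g
      map_smul' := fun c f => (Lp.smul_comm c φ f).symm }
    ‖φ‖ (fun f => Lp.norm_smul_le φ f)

theorem mulOp_coeFn (φ : Lp ℂ ∞ μ) (f : Lp H 2 μ) :
    ∀ᵐ x ∂μ, mulOp φ f x = φ x • f x :=
  Lp.coeFn_lpSMul (r := 2) φ f

variable (μ H) in
/-- A multiplication-invariant (MI) subspace of `L²(X; H)`: a closed subspace `V` with
`M_φ V ⊆ V` for every `φ ∈ L^∞(X)`. -/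
@[ext]
structure MISpace extends ClosedSubmodule ℂ (Lp H 2 μ) where
  mulOp_mem : ∀ (φ : Lp ℂ ∞ μ) (f : Lp H 2 μ), f ∈ toSubmodule → mulOp φ f ∈ toSubmodule

/-- The multiplication operator `M_φ` restricted to an MI space. -/
def MISpace.mul (V : MISpace μ H) (φ : Lp ℂ ∞ μ) : V.toSubmodule →L[ℂ] V.toSubmodule :=
  ((mulOp φ).comp V.toSubmodule.subtypeL).codRestrict V.toSubmodule
    (fun f => V.mulOp_mem φ f f.2)

/-- `T M_φ = M'_φ T`. -/
def CommutesWithMul {V : MISpace μ H} {V' : MISpace μ H'}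
    (T : V.toSubmodule →L[ℂ] V'.toSubmodule) (φ : Lp ℂ ∞ μ) : Prop :=
  T.comp (V.mul φ) = (V'.mul φ).comp T

/-- A bounded operator between MI spaces is an MI operator if it commutes with `M_φ` for every
`φ ∈ L^∞(X)`. -/
def IsMIOperator {V : MISpace μ H} {V' : MISpace μ H'}
    (T : V.toSubmodule →L[ℂ] V'.toSubmodule) : Prop :=
  ∀ φ : Lp ℂ ∞ μ, CommutesWithMul T φ

/-- A determining set for `L¹(X)`: a subset of `L^∞(X)` that separates the points of `L¹(X)`. -/
def IsDeterminingSet (D : Set (Lp ℂ ∞ μ)) : Prop :=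
  ∀ f₁ f₂ : Lp ℂ 1 μ, f₁ ≠ f₂ →
    ∃ g ∈ D, ∫ x, f₁ x * (starRingEnd ℂ) (g x) ∂μ ≠ ∫ x, f₂ x * (starRingEnd ℂ) (g x) ∂μ

end Mul

/-! ### Measurability of weakly measurable vector fields -/

section Weak

variable {X : Type u} [MeasurableSpace X] {μ : Measure X}
variable {H : Type v} [NormedAddCommGroup H] [InnerProductSpace ℂ H]

theorem countable_of_orthonormal [TopologicalSpace.SeparableSpace H] {s : Set H}
    (hs : Orthonormal ℂ ((↑) : s → H)) : s.Countable := by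
  have hd : s.PairwiseDisjoint (fun a => Metric.ball a (1 / 2 : ℝ)) := by
    intro a ha b hb hab
    refine Metric.ball_disjoint_ball ?_
    have h0 : inner ℂ a b = 0 := hs.2 (i := ⟨a, ha⟩) (j := ⟨b, hb⟩) (by simpa using hab)
    have h1 : ‖a‖ = 1 := hs.1 ⟨a, ha⟩
    have h2 : ‖b‖ = 1 := hs.1 ⟨b, hb⟩
    have h3 : ‖a - b‖ ^ 2 = 2 := by
      rw [@norm_sub_sq ℂ, h0, h1, h2]; norm_num
    rw [dist_eq_norm]
    nlinarith [norm_nonneg (a - b)]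
  exact hd.countable_of_isOpen (fun a _ => Metric.isOpen_ball)
    (fun a _ => ⟨a, Metric.mem_ball_self (by norm_num)⟩)

variable [CompleteSpace H] [TopologicalSpace.SeparableSpace H]

variable (H) in
theorem exists_countable_hilbertBasis :
    ∃ (s : Set H) (_ : HilbertBasis s ℂ H), s.Countable := by
  obtain ⟨s, b, hb⟩ := exists_hilbertBasis ℂ H
  exact ⟨s, b, countable_of_orthonormal (hb ▸ b.orthonormal)⟩

theorem aestronglyMeasurable_of_inner {f : X → H}
    (hf : ∀ v : H, AEStronglyMeasurable (fun x => inner ℂ v (f x)) μ) :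
    AEStronglyMeasurable f μ := by
  obtain ⟨s, b, hs⟩ := exists_countable_hilbertBasis H
  have : Countable s := hs
  refine aestronglyMeasurable_of_tendsto_ae (u := (atTop : Filter (Finset s)))
    (f := fun t x => ∑ i ∈ t, b.repr (f x) i • b i) (fun t => ?_)
    (Eventually.of_forall fun x => b.hasSum_repr (f x))
  refine Finset.aestronglyMeasurable_fun_sum t fun i _ => ?_
  simp only [b.repr_apply_apply]
  exact (hf (b i)).smul_const _

end Weak

/-! ### Range functions -/

section Range

variable {X : Type u} [MeasurableSpace X] {μ : Measure X}
variable {H : Type v} [NormedAddCommGroup H] [InnerProductSpace ℂ H] [CompleteSpace H]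

variable (X H) in
/-- A measurable `H`-valued range function: a choice of a closed subspace `J x` of `H` for every
`x`, such that `x ↦ ⟨P_J(x) u, v⟩` is measurable for all `u, v ∈ H`, where `P_J(x)` is the
orthogonal projection onto `J x`. -/
structure RangeFunction where
  space : X → ClosedSubmodule ℂ H
  measurable_proj : ∀ u v : H,
    Measurable fun x => inner ℂ v ((space x).toSubmodule.starProjection u)

/-- The fibre `J x`, as a subspace. -/
abbrev RangeFunction.fiber (J : RangeFunction X H) (x : X) : Submodule ℂ H :=
  (J.space x).toSubmodule

variable (X μ H) in
/-- Equality almost everywhere of range functions. -/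
def RangeFunction.aeSetoid : Setoid (RangeFunction X H) where
  r J J' := ∀ᵐ x ∂μ, J.space x = J'.space x
  iseqv :=
    { refl := fun _ => Eventually.of_forall fun _ => rfl
      symm := fun h => h.mono fun _ hx => hx.symm
      trans := fun h h' => by filter_upwards [h, h'] with x hx hx' using hx.trans hx' }

variable (μ) in
/-- `V_J = {f ∈ L²(X; H) : f x ∈ J x for a.e. x}`. -/
def RangeFunction.miSpace (J : RangeFunction X H) : MISpace μ H where
  carrier := {f | ∀ᵐ x ∂μ, f x ∈ J.space x}
  add_mem' := by
    intro f g hf hg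
    filter_upwards [hf, hg, Lp.coeFn_add f g] with x hx hx' h
    rw [h]
    exact add_mem hx hx'
  zero_mem' := by
    filter_upwards [Lp.coeFn_zero H 2 μ] with x hx
    rw [hx]
    exact zero_mem _
  smul_mem' := by
    intro c f hf
    filter_upwards [hf, Lp.coeFn_smul c f] with x hx h
    rw [h]
    exact (J.fiber x).smul_mem c hx
  isClosed' := by
    refine IsSeqClosed.isClosed ?_
    intro f g hf hfg
    obtain ⟨ns, -, hns⟩ := (tendstoInMeasure_of_tendsto_Lp hfg).exists_seq_tendsto_ae
    have hf' : ∀ᵐ x ∂μ, ∀ n, f n x ∈ J.space x := ae_all_iff.2 hf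
    filter_upwards [hns, hf'] with x hx hx'
    exact (J.space x).isClosed.mem_of_tendsto hx (Eventually.of_forall fun n => hx' (ns n))
  mulOp_mem := by
    intro φ f hf
    filter_upwards [hf, mulOp_coeFn φ f] with x hx h
    rw [h]
    exact (J.fiber x).smul_mem _ hx

theorem RangeFunction.mem_miSpace {J : RangeFunction X H} {f : Lp H 2 μ} :
    f ∈ (J.miSpace μ).toSubmodule ↔ ∀ᵐ x ∂μ, f x ∈ J.space x := Iff.rfl

theorem RangeFunction.miSpace_congr {J J' : RangeFunction X H}
    (h : ∀ᵐ x ∂μ, J.space x = J'.space x) : J.miSpace μ = J'.miSpace μ := by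
  have : (J.miSpace μ).toSubmodule = (J'.miSpace μ).toSubmodule := by
    ext f
    rw [mem_miSpace, mem_miSpace]
    refine eventually_congr ?_
    filter_upwards [h] with x hx
    rw [hx]
  exact MISpace.ext congr(($this : Set (Lp H 2 μ)))

end Range

/-! ### Range operators -/

section RangeOp

variable {X : Type u} [MeasurableSpace X] {μ : Measure X}
variable {H : Type v} [NormedAddCommGroup H] [InnerProductSpace ℂ H] [CompleteSpace H]
variable {H' : Type v'} [NormedAddCommGroup H'] [InnerProductSpace ℂ H'] [CompleteSpace H']
variable {H'' : Type w} [NormedAddCommGroup H''] [InnerProductSpace ℂ H''] [CompleteSpace H'']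

variable (μ) in
/-- A bounded measurable range operator `R : J → J'`: a choice of linear operators
`R x : J x → J' x` for every `x` whose operator norms are essentially bounded, such that
`x ↦ ⟨R(x) P_J(x) u, v⟩` is measurable for all `u ∈ H`, `v ∈ H'`. -/
structure RangeOperator (J : RangeFunction X H) (J' : RangeFunction X H') where
  op : ∀ x, J.fiber x →ₗ[ℂ] J'.fiber x
  bounded : ∃ C : ℝ, ∀ᵐ x ∂μ, ∀ u : J.fiber x, ‖op x u‖ ≤ C * ‖u‖
  measurable : ∀ (u : H) (v : H'),
    Measurable fun x => inner ℂ v (op x ((J.fiber x).orthogonalProjectionOnto u) : H')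

namespace RangeOperator

variable {J : RangeFunction X H} {J' : RangeFunction X H'}

/-- The operator `R(x) P_J(x) : H → H'`. -/
def ext (R : RangeOperator μ J J') (x : X) : H →ₗ[ℂ] H' :=
  (J'.fiber x).subtype ∘ₗ R.op x ∘ₗ
    ((J.fiber x).orthogonalProjectionOnto : H →ₗ[ℂ] J.fiber x)

theorem ext_mem (R : RangeOperator μ J J') (x : X) (u : H) : R.ext x u ∈ J'.space x :=
  (R.op x ((J.fiber x).orthogonalProjectionOnto u)).2

theorem ext_apply_of_mem (R : RangeOperator μ J J') {x : X} {u : H} (hu : u ∈ J.fiber x) :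
    R.ext x u = R.op x ⟨u, hu⟩ := by
  have : (J.fiber x).orthogonalProjectionOnto u = ⟨u, hu⟩ :=
    Submodule.orthogonalProjectionOnto_mem_subspace_eq_self (⟨u, hu⟩ : J.fiber x)
  simp [ext, this]

theorem exists_ext_bound (R : RangeOperator μ J J') :
    ∃ C : ℝ, ∀ᵐ x ∂μ, ∀ u : H, ‖R.ext x u‖ ≤ C * ‖u‖ := by
  obtain ⟨C, hC⟩ := R.bounded
  refine ⟨|C|, ?_⟩
  filter_upwards [hC] with x hx u
  calc ‖R.ext x u‖ ≤ C * ‖(J.fiber x).orthogonalProjectionOnto u‖ := hx _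
    _ ≤ |C| * ‖(J.fiber x).orthogonalProjectionOnto u‖ := by gcongr; exact le_abs_self C
    _ ≤ |C| * ‖u‖ := by
      gcongr
      exact Submodule.norm_orthogonalProjectionOnto_apply_le _ u

variable [TopologicalSpace.SeparableSpace H] [TopologicalSpace.SeparableSpace H']

theorem aestronglyMeasurable_ext (R : RangeOperator μ J J') {f : X → H}
    (hf : AEStronglyMeasurable f μ) : AEStronglyMeasurable (fun x => R.ext x (f x)) μ := by
  obtain ⟨C, hC⟩ := R.exists_ext_bound
  obtain ⟨s, b, hs⟩ := exists_countable_hilbertBasis H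
  have : Countable s := hs
  refine aestronglyMeasurable_of_tendsto_ae (u := (atTop : Filter (Finset s)))
    (f := fun t x => ∑ i ∈ t, b.repr (f x) i • R.ext x (b i)) (fun t => ?_) ?_
  · refine Finset.aestronglyMeasurable_fun_sum t fun i _ => ?_
    simp only [b.repr_apply_apply]
    refine AEStronglyMeasurable.smul (hf.const_inner (c := b i)) ?_
    exact aestronglyMeasurable_of_inner fun v =>
      (R.measurable (b i) v).aestronglyMeasurable
  · filter_upwards [hC] with x hx
    have := (b.hasSum_repr (f x)).mapL ((R.ext x).mkContinuous C hx)
    simpa [HasSum] using this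

theorem memLp_ext (R : RangeOperator μ J J') (f : Lp H 2 μ) :
    MemLp (fun x => R.ext x (f x)) 2 μ := by
  obtain ⟨C, hC⟩ := R.exists_ext_bound
  exact (Lp.memLp f).of_le_mul (R.aestronglyMeasurable_ext (Lp.aestronglyMeasurable f))
    (hC.mono fun x hx => hx (f x))

/-- The operator `f ↦ (x ↦ R(x) P_J(x) f(x))` from `L²(X; H)` to `L²(X; H')`. -/
def extL (R : RangeOperator μ J J') : Lp H 2 μ →L[ℂ] Lp H' 2 μ :=
  LinearMap.mkContinuousOfExistsBound
    { toFun := fun f => (R.memLp_ext f).toLp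
      map_add' := fun f g => by
        rw [← MemLp.toLp_add]
        apply MemLp.toLp_congr
        filter_upwards [Lp.coeFn_add f g] with x hx
        rw [hx]
        exact map_add (R.ext x) (f x) (g x)
      map_smul' := fun c f => by
        rw [RingHom.id_apply, ← MemLp.toLp_const_smul]
        apply MemLp.toLp_congr
        filter_upwards [Lp.coeFn_smul c f] with x hx
        rw [hx]
        exact map_smul (R.ext x) c (f x) }
    (by
      obtain ⟨C, hC⟩ := R.exists_ext_bound
      refine ⟨C, fun f => Lp.norm_le_mul_norm_of_ae_le_mul ?_⟩
      filter_upwards [hC, (R.memLp_ext f).coeFn_toLp] with x hx h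
      exact h ▸ hx (f x))

theorem extL_coeFn (R : RangeOperator μ J J') (f : Lp H 2 μ) :
    ∀ᵐ x ∂μ, R.extL f x = R.ext x (f x) :=
  (R.memLp_ext f).coeFn_toLp

theorem extL_mem (R : RangeOperator μ J J') (f : Lp H 2 μ) :
    R.extL f ∈ (J'.miSpace μ).toSubmodule := by
  rw [RangeFunction.mem_miSpace]
  filter_upwards [R.extL_coeFn f] with x hx
  rw [hx]
  exact R.ext_mem x _

theorem extL_mulOp (R : RangeOperator μ J J') (φ : Lp ℂ ∞ μ) (f : Lp H 2 μ) :
    R.extL (mulOp φ f) = mulOp φ (R.extL f) := by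
  apply Lp.ext
  filter_upwards [R.extL_coeFn f, R.extL_coeFn (mulOp φ f), mulOp_coeFn φ f,
    mulOp_coeFn φ (R.extL f)] with x h1 h2 h3 h4
  rw [h2, h3, h4, h1, map_smul]

/-- The decomposable operator `∫^⊕ R(x) dμ(x) : V_J → V_{J'}`, `f ↦ (x ↦ R(x)[f(x)])`. -/
def directIntegral (R : RangeOperator μ J J') :
    (J.miSpace μ).toSubmodule →L[ℂ] (J'.miSpace μ).toSubmodule :=
  (R.extL.comp (J.miSpace μ).toSubmodule.subtypeL).codRestrict (J'.miSpace μ).toSubmodule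
    (fun f => R.extL_mem f)

theorem directIntegral_coeFn (R : RangeOperator μ J J') (f : (J.miSpace μ).toSubmodule) :
    ∀ᵐ x ∂μ, ∃ h : (f : Lp H 2 μ) x ∈ J.fiber x,
      (R.directIntegral f : Lp H' 2 μ) x = R.op x ⟨(f : Lp H 2 μ) x, h⟩ := by
  filter_upwards [R.extL_coeFn f, RangeFunction.mem_miSpace.1 f.2] with x hx h
  exact ⟨h, hx.trans (R.ext_apply_of_mem h)⟩

theorem directIntegral_isMIOperator (R : RangeOperator μ J J') :
    IsMIOperator R.directIntegral :=
  fun φ => ContinuousLinearMap.ext fun f => Subtype.ext (R.extL_mulOp φ f)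


/-- Two range operators `J → J'` that agree a.e. define the same operator. -/
theorem directIntegral_congr {R S : RangeOperator μ J J'} (h : ∀ᵐ x ∂μ, R.op x = S.op x) :
    R.directIntegral = S.directIntegral := by
  refine ContinuousLinearMap.ext fun f => Subtype.ext (Lp.ext ?_)
  filter_upwards [h, R.directIntegral_coeFn f, S.directIntegral_coeFn f] with x hx h1 h2
  obtain ⟨_, h1⟩ := h1
  obtain ⟨_, h2⟩ := h2
  rw [h1, h2, hx]

variable (μ J J') in
/-- Equality almost everywhere of range operators `J → J'`. -/
def aeSetoid : Setoid (RangeOperator μ J J') where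
  r R S := ∀ᵐ x ∂μ, R.op x = S.op x
  iseqv :=
    { refl := fun _ => Eventually.of_forall fun _ => rfl
      symm := fun h => h.mono fun _ hx => hx.symm
      trans := fun h h' => by filter_upwards [h, h'] with x hx hx' using hx.trans hx' }

/-- The map `R ↦ ∫^⊕ R(x) dμ(x)` from bounded measurable range operators `J → J'` modulo equality
a.e. to MI operators `V_J → V_{J'}`. -/
def toMIOperator : Quotient (aeSetoid μ J J') →
    {T : (J.miSpace μ).toSubmodule →L[ℂ] (J'.miSpace μ).toSubmodule // IsMIOperator T} :=
  Quotient.lift (fun R => ⟨R.directIntegral, R.directIntegral_isMIOperator⟩)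
    (fun _ _ h => Subtype.ext (directIntegral_congr h))

variable (μ J) in
/-- The identity range operator of `J`. -/
def id : RangeOperator μ J J where
  op _ := LinearMap.id
  bounded := ⟨1, Eventually.of_forall fun x u => by simp⟩
  measurable u v := J.measurable_proj u v

variable {J₁ : RangeFunction X H'} {J₂ : RangeFunction X H''}

/-- The composition of range operators `R : J → J'` and `S : J₁ → J₂`, where `J₁ x = J' x` for
a.e. `x`. At the points `x` with `J₁ x = J' x` the projection `P_{J₁}(x)` is the identity of this
space and the composition is `S x ∘ R x`. -/
def comp [μ.IsComplete] [TopologicalSpace.SeparableSpace H'']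
    (S : RangeOperator μ J₁ J₂) (R : RangeOperator μ J J') : RangeOperator μ J J₂ where
  op x := S.op x ∘ₗ ((J₁.fiber x).orthogonalProjectionOnto : H' →ₗ[ℂ] J₁.fiber x) ∘ₗ
    (J'.fiber x).subtype ∘ₗ R.op x
  bounded := by
    obtain ⟨C, hC⟩ := R.bounded
    obtain ⟨D, hD⟩ := S.exists_ext_bound
    refine ⟨|D| * C, ?_⟩
    filter_upwards [hC, hD] with x h1 h2 u
    calc ‖S.ext x (R.op x u)‖ ≤ D * ‖(R.op x u : H')‖ := h2 _
      _ ≤ |D| * ‖(R.op x u : H')‖ := by gcongr; exact le_abs_self D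
      _ ≤ |D| * (C * ‖u‖) := by gcongr; exact h1 u
      _ = |D| * C * ‖u‖ := by ring
  measurable u v := by
    have h1 : AEStronglyMeasurable (fun x => R.ext x u) μ :=
      R.aestronglyMeasurable_ext aestronglyMeasurable_const
    have h2 : AEStronglyMeasurable (fun x => S.ext x (R.ext x u)) μ :=
      S.aestronglyMeasurable_ext h1
    exact ((h2.const_inner (𝕜 := ℂ) (c := v)).aemeasurable).nullMeasurable.measurable_of_complete

theorem comp_ext [μ.IsComplete] [TopologicalSpace.SeparableSpace H'']
    (S : RangeOperator μ J₁ J₂) (R : RangeOperator μ J J') (x : X) (u : H) :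
    (S.comp R).ext x u = S.ext x (R.ext x u) := rfl

end RangeOperator

end RangeOp

/-! ### The category of measurable range functions -/

section Categories

variable {X : Type u} [MeasurableSpace X]

/-- An object of `X-Ran`: a separable Hilbert space `K` together with an equivalence class (modulo
equality a.e.) of measurable `K`-valued range functions. -/
structure XRan (μ : Measure X) : Type (max u (w + 1)) where
  K : Type w
  [normed : NormedAddCommGroup K]
  [inner : InnerProductSpace ℂ K]
  [complete : CompleteSpace K]
  [separable : TopologicalSpace.SeparableSpace K]
  cls : Quotient (RangeFunction.aeSetoid X μ K)

/-- An object of `X-MI`: a separable Hilbert space `K` together with an MI subspace of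
`L²(X; K)`. -/
structure XMI (μ : Measure X) : Type (max u (w + 1)) where
  K : Type w
  [normed : NormedAddCommGroup K]
  [inner : InnerProductSpace ℂ K]
  [complete : CompleteSpace K]
  [separable : TopologicalSpace.SeparableSpace K]
  space : MISpace μ K

attribute [instance] XRan.normed XRan.inner XRan.complete XRan.separable
attribute [instance] XMI.normed XMI.inner XMI.complete XMI.separable

variable {μ : Measure X}

/-- A bounded measurable range operator `dom → cod` between representatives of the classes of
range functions `A` and `B`. -/
structure XRan.PreHom (A B : XRan.{u, w} μ) : Type (max u w) where
  dom : RangeFunction X A.K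
  cod : RangeFunction X B.K
  dom_mem : Quotient.mk (RangeFunction.aeSetoid X μ A.K) dom = A.cls
  cod_mem : Quotient.mk (RangeFunction.aeSetoid X μ B.K) cod = B.cls
  op : RangeOperator μ dom cod

/-- Equality almost everywhere of range operators between representatives. Two representatives of
the same class agree a.e., and where `R` and `S` have the same domain `J x` the condition
`R(x) P_J(x) u = S(x) P_J(x) u` for all `u` says that `R x` and `S x` are the same map. -/
def XRan.homSetoid (A B : XRan.{u, w} μ) : Setoid (XRan.PreHom A B) where
  r R S := ∀ᵐ x ∂μ, ∀ u : A.K, R.op.ext x u = S.op.ext x u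
  iseqv :=
    { refl := fun _ => Eventually.of_forall fun _ _ => rfl
      symm := fun h => h.mono fun _ hx u => (hx u).symm
      trans := fun h h' => by
        filter_upwards [h, h'] with x hx hx' u using (hx u).trans (hx' u) }

/-- The morphisms of `X-Ran`: equivalence classes of bounded measurable range operators. -/
def XRan.Hom (A B : XRan.{u, w} μ) : Type (max u w) := Quotient (XRan.homSetoid A B)

theorem XRan.ae_eq_of_mem {A : XRan.{u, w} μ} {J J' : RangeFunction X A.K}
    (h : Quotient.mk (RangeFunction.aeSetoid X μ A.K) J = A.cls)
    (h' : Quotient.mk (RangeFunction.aeSetoid X μ A.K) J' = A.cls) :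
    ∀ᵐ x ∂μ, J.space x = J'.space x :=
  Quotient.exact (s := RangeFunction.aeSetoid X μ A.K) (h.trans h'.symm)

/-- The identity of a representative. -/
def XRan.PreHom.id (A : XRan.{u, w} μ) : XRan.PreHom A A where
  dom := Quotient.out A.cls
  cod := Quotient.out A.cls
  dom_mem := Quotient.out_eq _
  cod_mem := Quotient.out_eq _
  op := RangeOperator.id μ _

/-- Composition of range operators between representatives. -/
def XRan.PreHom.comp [μ.IsComplete] {A B C : XRan.{u, w} μ} (R : XRan.PreHom A B)
    (S : XRan.PreHom B C) : XRan.PreHom A C where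
  dom := R.dom
  cod := S.cod
  dom_mem := R.dom_mem
  cod_mem := S.cod_mem
  op := S.op.comp R.op

theorem XRan.PreHom.ext_proj_dom {A B : XRan.{u, w} μ} (R : XRan.PreHom A B)
    {J : RangeFunction X A.K} (h : Quotient.mk (RangeFunction.aeSetoid X μ A.K) J = A.cls) :
    ∀ᵐ x ∂μ, ∀ u, R.op.ext x ((J.fiber x).starProjection u) = R.op.ext x u := by
  filter_upwards [XRan.ae_eq_of_mem h R.dom_mem] with x hx u
  have key : ∀ L : ClosedSubmodule ℂ A.K, L = R.dom.space x →
      R.op.ext x (L.toSubmodule.starProjection u) = R.op.ext x u := by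
    rintro _ rfl
    exact congrArg (fun z => (R.op.op x z : B.K))
      (Submodule.orthogonalProjectionOnto_mem_subspace_eq_self
        ((R.dom.fiber x).orthogonalProjectionOnto u))
  exact key _ hx

theorem XRan.PreHom.proj_cod_ext {A B : XRan.{u, w} μ} (R : XRan.PreHom A B)
    {J : RangeFunction X B.K} (h : Quotient.mk (RangeFunction.aeSetoid X μ B.K) J = B.cls) :
    ∀ᵐ x ∂μ, ∀ u, (J.fiber x).starProjection (R.op.ext x u) = R.op.ext x u := by
  filter_upwards [XRan.ae_eq_of_mem h R.cod_mem] with x hx u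
  refine Submodule.starProjection_eq_self_iff.2 ?_
  have := R.op.ext_mem x u
  rw [← hx] at this
  exact this

/-- The category `X-Ran` of measurable range functions and range operators. -/
instance XRan.category [μ.IsComplete] : Category.{max u w} (XRan.{u, w} μ) where
  Hom := XRan.Hom
  id A := Quotient.mk _ (XRan.PreHom.id A)
  comp := fun {A B C} f g => Quotient.map₂ XRan.PreHom.comp (by
    intro R R' hR S S' hS
    filter_upwards [hR, hS] with x h1 h2 u
    exact (congrArg (S.op.ext x) (h1 u)).trans (h2 _)) f g
  id_comp := by
    intro A B f
    induction f using Quotient.inductionOn with | _ R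
    exact Quotient.sound (R.ext_proj_dom (Quotient.out_eq _))
  comp_id := by
    intro A B f
    induction f using Quotient.inductionOn with | _ R
    exact Quotient.sound (R.proj_cod_ext (Quotient.out_eq _))
  assoc := by
    intro A B C D f g h
    induction f using Quotient.inductionOn with | _ R
    induction g using Quotient.inductionOn with | _ S
    induction h using Quotient.inductionOn with | _ T
    rfl

/-! ### The category of multiplication-invariant spaces -/

/-- The category `X-MI` of MI spaces and MI operators. -/
instance XMI.category : Category.{max u w} (XMI.{u, w} μ) where
  Hom A B := {T : A.space.toSubmodule →L[ℂ] B.space.toSubmodule // IsMIOperator T}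
  id A := ⟨ContinuousLinearMap.id ℂ _, fun _ => rfl⟩
  comp S T := ⟨T.1.comp S.1, fun φ => by
    have h1 := S.2 φ
    have h2 := T.2 φ
    unfold CommutesWithMul at *
    rw [ContinuousLinearMap.comp_assoc, h1, ← ContinuousLinearMap.comp_assoc, h2,
      ContinuousLinearMap.comp_assoc]⟩

/-! ### The functor from range functions to multiplication-invariant spaces -/

/-- `V_J` for an equivalence class of range functions `J`. -/
def XRan.miSpace (A : XRan.{u, w} μ) : MISpace μ A.K :=
  Quotient.lift (fun J : RangeFunction X A.K => J.miSpace μ)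
    (fun _ _ h => RangeFunction.miSpace_congr h) A.cls

theorem XRan.miSpace_eq (A : XRan.{u, w} μ) {J : RangeFunction X A.K}
    (h : Quotient.mk (RangeFunction.aeSetoid X μ A.K) J = A.cls) :
    A.miSpace = J.miSpace μ := by
  rw [XRan.miSpace, ← h]
  rfl

/-- `∫^⊕ R(x) dμ(x) : V_J → V_{J'}` for a range operator `R` between representatives. -/
def XRan.PreHom.toMIOperator {A B : XRan.{u, w} μ} (R : XRan.PreHom A B) :
    {T : A.miSpace.toSubmodule →L[ℂ] B.miSpace.toSubmodule // IsMIOperator T} :=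
  ⟨(R.op.extL.comp A.miSpace.toSubmodule.subtypeL).codRestrict B.miSpace.toSubmodule
      (fun f => by
        rw [B.miSpace_eq R.cod_mem]
        exact R.op.extL_mem f),
    fun φ => ContinuousLinearMap.ext fun f => Subtype.ext (R.op.extL_mulOp φ f)⟩

theorem XRan.PreHom.toMIOperator_coeFn {A B : XRan.{u, w} μ} (R : XRan.PreHom A B)
    (f : A.miSpace.toSubmodule) :
    ∀ᵐ x ∂μ, ∃ h : (f : Lp A.K 2 μ) x ∈ R.dom.fiber x,
      (R.toMIOperator.1 f : Lp B.K 2 μ) x = R.op.op x ⟨(f : Lp A.K 2 μ) x, h⟩ := by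
  have hf : (f : Lp A.K 2 μ) ∈ (R.dom.miSpace μ).toSubmodule := by
    rw [← A.miSpace_eq R.dom_mem]
    exact f.2
  exact R.op.directIntegral_coeFn ⟨f, hf⟩

variable (μ) in
/-- The functor `F : X-Ran ⥤ X-MI` with `F(J) = V_J` and `F(R) = ∫^⊕ R(x) dμ(x)`. -/
def functorF [μ.IsComplete] : XRan.{u, w} μ ⥤ XMI.{u, w} μ where
  obj A := { K := A.K, space := A.miSpace }
  map {A B} f := Quotient.lift (s := XRan.homSetoid A B) XRan.PreHom.toMIOperator (by
    intro R S h
    refine Subtype.ext (ContinuousLinearMap.ext fun f => Subtype.ext (Lp.ext ?_))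
    filter_upwards [h, R.op.extL_coeFn f, S.op.extL_coeFn f] with x hx h1 h2
    exact h1.trans ((hx _).trans h2.symm)) f
  map_id A := by
    refine Subtype.ext (ContinuousLinearMap.ext fun f => Subtype.ext (Lp.ext ?_))
    filter_upwards [(XRan.PreHom.id A).toMIOperator_coeFn f] with x hx
    obtain ⟨_, hx⟩ := hx
    exact hx
  map_comp {A B C} f g := by
    induction f using Quotient.inductionOn with | _ R
    induction g using Quotient.inductionOn with | _ S
    refine Subtype.ext (ContinuousLinearMap.ext fun f => Subtype.ext (Lp.ext ?_))
    filter_upwards [R.op.extL_coeFn f, S.op.extL_coeFn (R.op.extL f),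
      (S.op.comp R.op).extL_coeFn f] with x h1 h2 h3
    exact h3.trans ((congrArg (S.op.ext x) h1).symm.trans h2.symm)

end Categories

end MultInv

end

open MultInv

/-! Everything rests on one fact (`RangeOperator.exists_extL_eq`): a bounded `S : L²(X; H) → L²(X;
H')` that commutes with all multiplications acts fibrewise. Commuting with indicators localizes the
norm bound to every measurable set, hence `‖S f(x)‖ ≤ ‖S‖ ‖f(x)‖` a.e. By σ-finiteness there is a
scalar `w ∈ L²` with `w ≠ 0` a.e.; for a countable Hilbert basis `b`, the functions `S(w bᵢ)/w` must
be the values `N(x) bᵢ`. The pointwise bound makes `N(x)` bounded on finite combinations of the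
`bᵢ`, so it extends to `H`. Vectors `w bᵢ` generate `L²(X; H)` under multiplications, so `S` is the
operator with fibres `N(x)`.

For (A), an operator `T : V_J → V_{J'}` is extended by zero on the complement of `V_J`; the
projection onto `V_J` is pointwise, so commutation is preserved, and the fibres `N(x)` are
compressed to `J(x) → J'(x)`. A determining set suffices because commutation with `M_φ` says that
`φ` integrates equally against the `L¹` functions `⟨S*g, f⟩` and `⟨g, S f⟩`.

For (B), the projection onto an MI space `V` commutes with multiplications, so it is fibrewise, its
fibres are orthogonal projections a.e., and their ranges form a `J` with `V_J = V`. Thus `F` is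
bijective on objects; by (A) it is fully faithful, so it has a strict inverse. -/

namespace MultInv

/-! ### Operators commuting with multiplications -/

section Multiplication

variable {X : Type u} [MeasurableSpace X] {μ : Measure X}
variable {H : Type v} [NormedAddCommGroup H] [InnerProductSpace ℂ H]
variable {H' : Type v'} [NormedAddCommGroup H'] [InnerProductSpace ℂ H']

/-- The exceptional null set depends on `y`; a countable dense set of `y` needs only one null set,
and closedness covers the rest. -/
theorem ae_forall_of_isClosed {Y : Type*} [TopologicalSpace Y] [TopologicalSpace.SeparableSpace Y]
    {p : X → Y → Prop} (hc : ∀ᵐ x ∂μ, IsClosed {y | p x y}) (h : ∀ y, ∀ᵐ x ∂μ, p x y) :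
    ∀ᵐ x ∂μ, ∀ y, p x y := by
  obtain ⟨s, hs, hd⟩ := TopologicalSpace.exists_countable_dense Y
  filter_upwards [hc, (ae_ball_iff hs).2 fun y _ => h y] with x hx h y
  exact closure_minimal (s := s) (fun y hy => h y hy) hx (hd y)

variable (μ) in
/-- A square-integrable function that vanishes almost nowhere. -/
theorem exists_Lp_two_ae_ne_zero [SigmaFinite μ] : ∃ w : Lp ℂ 2 μ, ∀ᵐ x ∂μ, w x ≠ 0 := by
  obtain ⟨g, hg0, hgm, hg⟩ := exists_pos_lintegral_lt_of_sigmaFinite μ (ε := 1) one_ne_zero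
  -- The witness is `w = √g`, where `g > 0` has finite integral.
  have hm : AEStronglyMeasurable (fun x => ((√(g x : ℝ) : ℝ) : ℂ)) μ :=
    (Complex.measurable_ofReal.comp (Real.continuous_sqrt.measurable.comp
      hgm.coe_nnreal_real)).aestronglyMeasurable
  have hL : MemLp (fun x => ((√(g x : ℝ) : ℝ) : ℂ)) 2 μ := by
    rw [memLp_two_iff_integrable_sq_norm hm]
    have : (fun x => ‖((√(g x : ℝ) : ℝ) : ℂ)‖ ^ 2) = fun x => (g x : ℝ) := by
      funext x
      rw [Complex.norm_real, Real.norm_eq_abs, sq_abs, Real.sq_sqrt (g x).coe_nonneg]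
    rw [this]
    refine ⟨hgm.coe_nnreal_real.aestronglyMeasurable, ?_⟩
    rw [hasFiniteIntegral_iff_enorm]
    refine lt_of_le_of_lt (le_of_eq (lintegral_congr fun x => ?_)) (hg.trans ENNReal.one_lt_top)
    simp
  refine ⟨hL.toLp, ?_⟩
  filter_upwards [hL.coeFn_toLp] with x hx
  rw [hx, Ne, Complex.ofReal_eq_zero, Real.sqrt_eq_zero (g x).coe_nonneg]
  exact_mod_cast (hg0 x).ne'

/-- The vector `x ↦ w x • u` of `L²(X; H)`. -/
noncomputable def weighted (w : Lp ℂ 2 μ) : H →ₗ[ℂ] Lp H 2 μ where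
  toFun u := (ContinuousLinearMap.toSpanSingleton ℂ u).compLp w
  map_add' u u' := by
    rw [ContinuousLinearMap.toSpanSingleton_add, ContinuousLinearMap.add_compLp]
  map_smul' c u := by
    rw [ContinuousLinearMap.toSpanSingleton_smul, ContinuousLinearMap.smul_compLp,
      RingHom.id_apply]

theorem weighted_coeFn (w : Lp ℂ 2 μ) (u : H) : ∀ᵐ x ∂μ, weighted w u x = w x • u :=
  (ContinuousLinearMap.toSpanSingleton ℂ u).coeFn_compLp w

variable (μ) in
/-- The class in `L^∞(X)` of the indicator function of a measurable set. -/
noncomputable def indicatorLp {s : Set X} (hs : MeasurableSet s) : Lp ℂ ∞ μ :=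
  ((memLp_top_const (1 : ℂ)).indicator hs).toLp

theorem indicatorLp_coeFn {s : Set X} (hs : MeasurableSet s) :
    ∀ᵐ x ∂μ, indicatorLp μ hs x = s.indicator (fun _ => (1 : ℂ)) x :=
  ((memLp_top_const (1 : ℂ)).indicator hs).coeFn_toLp

theorem integral_indicatorLp_mul {s : Set X} (hs : MeasurableSet s) (h : X → ℂ) :
    ∫ x, indicatorLp μ hs x * h x ∂μ = ∫ x in s, h x ∂μ := by
  rw [← integral_indicator hs]
  refine integral_congr_ae ?_
  filter_upwards [indicatorLp_coeFn (μ := μ) hs] with x hx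
  rw [hx]
  by_cases hxs : x ∈ s <;> simp [hxs]

theorem ae_eq_of_forall_integral_mul_eq {h₁ h₂ : X → ℂ} (hi₁ : Integrable h₁ μ)
    (hi₂ : Integrable h₂ μ)
    (h : ∀ φ : Lp ℂ ∞ μ, ∫ x, φ x * h₁ x ∂μ = ∫ x, φ x * h₂ x ∂μ) : h₁ =ᵐ[μ] h₂ := by
  refine Integrable.ae_eq_of_forall_setIntegral_eq _ _ hi₁ hi₂ fun s hs _ => ?_
  rw [← integral_indicatorLp_mul hs, h, integral_indicatorLp_mul hs]

theorem inner_mulOp_right (φ : Lp ℂ ∞ μ) (f g : Lp H 2 μ) :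
    inner ℂ g (mulOp φ f) = ∫ x, φ x * inner ℂ (g x) (f x) ∂μ := by
  rw [L2.inner_def]
  refine integral_congr_ae ?_
  filter_upwards [mulOp_coeFn φ f] with x hx
  rw [hx, inner_smul_right]

/-- Vectors whose products with all `M_φ f` vanish are pointwise orthogonal to `f`. -/
theorem ae_inner_eq_zero {f g : Lp H 2 μ} (h : ∀ φ : Lp ℂ ∞ μ, inner ℂ g (mulOp φ f) = 0) :
    ∀ᵐ x ∂μ, inner ℂ (g x) (f x) = 0 := by
  refine ae_eq_of_forall_integral_mul_eq (h₂ := fun _ => 0) (L2.integrable_inner g f)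
    (integrable_zero _ _ _) fun φ => ?_
  rw [← inner_mulOp_right, h]
  simp

theorem norm_sq_mulOp_indicatorLp {s : Set X} (hs : MeasurableSet s) (f : Lp H 2 μ) :
    ‖mulOp (indicatorLp μ hs) f‖ ^ 2 = ∫ x in s, ‖f x‖ ^ 2 ∂μ := by
  have h : (‖mulOp (indicatorLp μ hs) f‖ : ℂ) ^ 2 = ((∫ x in s, ‖f x‖ ^ 2 ∂μ : ℝ) : ℂ) := by
    have h0 : inner ℂ (mulOp (indicatorLp μ hs) f) (mulOp (indicatorLp μ hs) f) =
        (‖mulOp (indicatorLp μ hs) f‖ : ℂ) ^ 2 := inner_self_eq_norm_sq_to_K _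
    rw [← h0, L2.inner_def, ← integral_complex_ofReal, ← integral_indicator hs]
    refine integral_congr_ae ?_
    filter_upwards [indicatorLp_coeFn (μ := μ) hs, mulOp_coeFn (indicatorLp μ hs) f] with x h1 h2
    rw [h2, h1]
    by_cases hxs : x ∈ s
    · simp [hxs, inner_self_eq_norm_sq_to_K]
    · simp [hxs]
  exact_mod_cast h

/-- An operator that commutes with multiplications is bounded pointwise by its norm. -/
theorem ae_norm_apply_le {S : Lp H 2 μ →L[ℂ] Lp H' 2 μ}
    (hS : ∀ φ f, S (mulOp φ f) = mulOp φ (S f)) (f : Lp H 2 μ) :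
    ∀ᵐ x ∂μ, ‖S f x‖ ≤ ‖S‖ * ‖f x‖ := by
  -- For measurable `s`, the integral of `‖S f‖²` over `s` is `‖S (1_s f)‖²`, at most `‖S‖² ‖1_s
  -- f‖²`.
  have key : (fun x => ‖S f x‖ ^ 2) ≤ᵐ[μ] fun x => ‖S‖ ^ 2 * ‖f x‖ ^ 2 := by
    refine ae_le_of_forall_setIntegral_le (Lp.memLp _).norm.integrable_sq
      ((Lp.memLp f).norm.integrable_sq.const_mul _) fun s hs _ => ?_
    rw [integral_const_mul, ← norm_sq_mulOp_indicatorLp hs, ← norm_sq_mulOp_indicatorLp hs, ← hS,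
      ← mul_pow]
    gcongr
    exact S.le_opNorm _
  filter_upwards [key] with x hx
  rw [← mul_pow] at hx
  exact le_of_sq_le_sq hx (by positivity)

/-- An operator that commutes with multiplications is determined by its values on the vectors
`w • b i`, where `b` is a Hilbert basis and `w` vanishes almost nowhere. -/
theorem eq_of_apply_weighted_eq [CompleteSpace H] {w : Lp ℂ 2 μ} (hw : ∀ᵐ x ∂μ, w x ≠ 0)
    {S S' : Lp H 2 μ →L[ℂ] Lp H' 2 μ}
    (hS : ∀ φ f, S (mulOp φ f) = mulOp φ (S f)) (hS' : ∀ φ f, S' (mulOp φ f) = mulOp φ (S' f))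
    {ι : Type*} [Countable ι] (b : HilbertBasis ι ℂ H)
    (h : ∀ i, S (weighted w (b i)) = S' (weighted w (b i))) : S = S' := by
  -- The kernel is stable under multiplications, so a vector `g` orthogonal to it is orthogonal to
  -- every `M_φ (w bᵢ)`. Hence `g(x) ⊥ w(x) bᵢ` a.e. for all `i`, and `g = 0`.
  have hK : (LinearMap.ker (S - S').toLinearMap)ᗮ = ⊥ := by
    rw [Submodule.eq_bot_iff]
    intro g hg
    have h0 : ∀ i, ∀ᵐ x ∂μ, inner ℂ (g x) (weighted w (b i) x) = 0 := fun i =>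
      ae_inner_eq_zero fun φ => Submodule.inner_left_of_mem_orthogonal
        (by simp [LinearMap.mem_ker, hS, hS', h]) hg
    rw [Lp.eq_zero_iff_ae_eq_zero]
    filter_upwards [hw, ae_all_iff.2 h0, ae_all_iff.2 fun i => weighted_coeFn w (b i)]
      with x hx h1 h2
    refine b.repr.injective ?_
    ext i
    have h3 := h1 i
    rw [h2, inner_smul_right, mul_eq_zero, or_iff_right hx] at h3
    rw [b.repr_apply_apply, inner_eq_zero_symm.1 h3]
    simp
  have : CompleteSpace (LinearMap.ker (S - S').toLinearMap) :=
    (S - S').isClosed_ker.completeSpace_coe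
  rw [Submodule.orthogonal_eq_bot_iff] at hK
  ext1 f
  have hf : f ∈ LinearMap.ker (S - S').toLinearMap := hK ▸ Submodule.mem_top
  exact sub_eq_zero.1 hf

end Multiplication
-- Decomposition into fibres
section Decomposition

variable {X : Type u} [MeasurableSpace X] {μ : Measure X}
variable {H : Type v} [NormedAddCommGroup H] [InnerProductSpace ℂ H] [CompleteSpace H]
variable {H' : Type v'} [NormedAddCommGroup H'] [InnerProductSpace ℂ H'] [CompleteSpace H']

variable (X H) in
/-- The constant range function with fibre the whole space. -/
noncomputable def RangeFunction.full : RangeFunction X H where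
  space _ := ⊤
  measurable_proj u v := by
    simp only [ClosedSubmodule.toSubmodule_top, Submodule.starProjection_top]
    exact measurable_const

theorem RangeFunction.mem_full (x : X) (u : H) : u ∈ (RangeFunction.full X H).fiber x := trivial

theorem RangeFunction.full_starProjection (x : X) (u : H) :
    ((RangeFunction.full X H).fiber x).starProjection u = u :=
  Submodule.starProjection_eq_self_iff.2 (mem_full x u)

namespace RangeOperator

variable {J : RangeFunction X H} {J' : RangeFunction X H'}

/-- The range operator `J → J'` given by linear maps on the whole space that map `J x` to `J' x`. -/
noncomputable def ofLinear (N : X → H →ₗ[ℂ] H') (hN : ∀ x, ∀ u ∈ J.fiber x, N x u ∈ J'.fiber x)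
    (hb : ∃ C : ℝ, ∀ᵐ x ∂μ, ∀ u, ‖N x u‖ ≤ C * ‖u‖)
    (hm : ∀ u v, Measurable fun x => inner ℂ v (N x ((J.fiber x).starProjection u))) :
    RangeOperator μ J J' where
  op x := (N x).restrict (hN x)
  bounded := hb.imp fun _ hC => hC.mono fun _ hx u => hx u
  measurable := hm

theorem ofLinear_ext {N : X → H →ₗ[ℂ] H'} {hN : ∀ x, ∀ u ∈ J.fiber x, N x u ∈ J'.fiber x}
    {hb : ∃ C : ℝ, ∀ᵐ x ∂μ, ∀ u, ‖N x u‖ ≤ C * ‖u‖}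
    {hm : ∀ u v, Measurable fun x => inner ℂ v (N x ((J.fiber x).starProjection u))}
    (x : X) (u : H) :
    (ofLinear N hN hb hm).ext x u = N x ((J.fiber x).starProjection u) := rfl

variable (μ J) in
/-- The orthogonal projections onto the fibres of `J`. -/
noncomputable def proj : RangeOperator μ (RangeFunction.full X H) J :=
  ofLinear (fun x => ((J.fiber x).starProjection : H →ₗ[ℂ] H))
    (fun x _ _ => Submodule.starProjection_apply_mem (J.fiber x) _)
    ⟨1, Eventually.of_forall fun x u => by
      rw [one_mul]; exact Submodule.norm_starProjection_apply_le _ u⟩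
    (fun u v => by
      simp only [RangeFunction.full_starProjection]
      exact J.measurable_proj u v)

theorem proj_ext (x : X) (u : H) : (proj μ J).ext x u = (J.fiber x).starProjection u := by
  rw [proj, ofLinear_ext, RangeFunction.full_starProjection]; rfl

variable (μ J) in
/-- The inclusions of the fibres of `J`. -/
noncomputable def incl : RangeOperator μ J (RangeFunction.full X H) :=
  ofLinear (fun _ => LinearMap.id) (fun _ _ _ => RangeFunction.mem_full _ _)
    ⟨1, Eventually.of_forall fun x u => by simp⟩ J.measurable_proj

theorem incl_ext (x : X) (u : H) : (incl μ J).ext x u = (J.fiber x).starProjection u := rfl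

/-- Range operators whose extensions agree are equal. -/
theorem op_eq_of_ext_eq {R S : RangeOperator μ J J'} {x : X} (h : ∀ u, R.ext x u = S.ext x u) :
    R.op x = S.op x := by
  ext u
  rw [← R.ext_apply_of_mem u.2, ← S.ext_apply_of_mem u.2, h]

variable [TopologicalSpace.SeparableSpace H] [TopologicalSpace.SeparableSpace H']

theorem proj_extL_eq_self {f : Lp H 2 μ} (hf : f ∈ (J.miSpace μ).toSubmodule) :
    (proj μ J).extL f = f := by
  apply Lp.ext
  filter_upwards [(proj μ J).extL_coeFn f, RangeFunction.mem_miSpace.1 hf] with x h1 h2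
  rw [h1, proj_ext]
  exact Submodule.starProjection_eq_self_iff.2 h2

/-- Evaluation at `w u` allows `w(x)` to be cancelled. The range functions may differ, as happens
for two representatives of one morphism of `XRan`. -/
theorem ae_ext_eq_of_extL_eq [SigmaFinite μ] {J₁ : RangeFunction X H} {J₁' : RangeFunction X H'}
    {R : RangeOperator μ J J'} {S : RangeOperator μ J₁ J₁'} (h : ∀ f, R.extL f = S.extL f) :
    ∀ᵐ x ∂μ, ∀ u, R.ext x u = S.ext x u := by
  obtain ⟨w, hw⟩ := exists_Lp_two_ae_ne_zero μ
  obtain ⟨C, hC⟩ := R.exists_ext_bound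
  obtain ⟨D, hD⟩ := S.exists_ext_bound
  refine ae_forall_of_isClosed ?_ fun u => ?_
  · filter_upwards [hC, hD] with x h1 h2
    exact isClosed_eq ((R.ext x).mkContinuous C h1).continuous
      ((S.ext x).mkContinuous D h2).continuous
  · filter_upwards [hw, weighted_coeFn w u, R.extL_coeFn (weighted w u),
      S.extL_coeFn (weighted w u)] with x h0 h1 h2 h3
    have h4 := h2.symm.trans ((congrArg (fun f : Lp H' 2 μ => f x) (h _)).trans h3)
    rw [h1, map_smul, map_smul] at h4
    exact smul_right_injective _ h0 h4

/-- Every bounded operator on `L²(X; H)` that commutes with multiplications is decomposable. -/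
theorem exists_extL_eq [SigmaFinite μ] [μ.IsComplete] {S : Lp H 2 μ →L[ℂ] Lp H' 2 μ}
    (hS : ∀ φ f, S (mulOp φ f) = mulOp φ (S f)) :
    ∃ R : RangeOperator μ (RangeFunction.full X H) (RangeFunction.full X H'), R.extL = S := by
  obtain ⟨w, hw⟩ := exists_Lp_two_ae_ne_zero μ
  obtain ⟨s, b, hs⟩ := exists_countable_hilbertBasis H
  have : Countable s := hs
  -- The forced value of `N(x) bᵢ`, since a fibrewise `S` satisfies `S(w bᵢ)(x) = w(x) N(x) bᵢ`.
  let A : s → X → H' := fun i x => (w x)⁻¹ • S (weighted w (b i)) x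
  have hA : ∀ i, AEStronglyMeasurable (A i) μ := fun i =>
    (Lp.aestronglyMeasurable w).inv₀.smul (Lp.aestronglyMeasurable _)
  let L : X → (s →₀ ℂ) →ₗ[ℂ] H' := fun x => Finsupp.linearCombination ℂ fun i => A i x
  let U : (s →₀ ℂ) →ₗ[ℂ] H := Finsupp.linearCombination ℂ b
  have hU : DenseRange U := by
    have h := Submodule.dense_iff_topologicalClosure_eq_top.2 b.dense_span
    rwa [← Finsupp.range_linearCombination] at h
  have hL : ∀ᵐ x ∂μ, ∀ c, ‖L x c‖ ≤ ‖S‖ * ‖U c‖ := by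
    -- There are countably many finite `t`, and for each the coefficients range over the separable
    -- space `s → ℂ`, so a single null set serves all combinations.
    have h1 : ∀ t : Finset s, ∀ᵐ x ∂μ, ∀ c : s → ℂ,
        ‖∑ i ∈ t, c i • A i x‖ ≤ ‖S‖ * ‖∑ i ∈ t, c i • b i‖ := by
      intro t
      refine ae_forall_of_isClosed (Eventually.of_forall fun x => ?_) fun c => ?_
      · exact isClosed_le (by fun_prop) (by fun_prop)
      · have hsum : S (weighted w (∑ i ∈ t, c i • b i)) =
            ∑ i ∈ t, c i • S (weighted w (b i)) := by
          simp only [map_sum, map_smul]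
        filter_upwards [hw, ae_norm_apply_le hS (weighted w (∑ i ∈ t, c i • b i)),
          weighted_coeFn w (∑ i ∈ t, c i • b i),
          Lp.coeFn_fun_finsetSum t fun i => c i • S (weighted w (b i)),
          ae_all_iff.2 fun i => Lp.coeFn_smul (c i) (S (weighted w (b i)))] with x h0 h1 h2 h3 h4
        rw [hsum, h3, h2] at h1
        have h5 : ∑ i ∈ t, c i • A i x =
            (w x)⁻¹ • ∑ i ∈ t, (c i • S (weighted w (b i)) : Lp H' 2 μ) x := by
          rw [Finset.smul_sum]
          refine Finset.sum_congr rfl fun i _ => ?_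
          rw [h4, Pi.smul_apply, smul_comm]
        rw [h5, norm_smul, norm_inv]
        rw [norm_smul] at h1
        have h6 : 0 < ‖w x‖ := norm_pos_iff.2 h0
        rw [inv_mul_le_iff₀ h6]
        linarith
    filter_upwards [ae_all_iff.2 h1] with x hx c
    exact hx c.support c
  -- The map `U c ↦ L x c` on the dense span of the basis, extended by continuity; values on the
  -- null set where `hL` fails play no role.
  let N : X → H →ₗ[ℂ] H' := fun x => ((L x).extendOfNorm U).toLinearMap
  have hN : ∀ᵐ x ∂μ, ∀ u, ‖N x u‖ ≤ ‖S‖ * ‖u‖ := by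
    filter_upwards [hL] with x hx u
    exact LinearMap.norm_extendOfNorm_apply_le hU _ hx u
  have hNb : ∀ᵐ x ∂μ, ∀ i, N x (b i) = A i x := by
    filter_upwards [hL] with x hx i
    have h := LinearMap.extendOfNorm_eq hU ⟨_, hx⟩ (Finsupp.single i 1)
    simp only [U, L, Finsupp.linearCombination_single, one_smul] at h
    exact h
  have hNm : ∀ u v, Measurable fun x => inner ℂ v (N x u) := by
    intro u v
    have h : AEStronglyMeasurable (fun x => N x u) μ := by
      refine aestronglyMeasurable_of_tendsto_ae (u := (atTop : Filter (Finset s)))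
        (f := fun t x => ∑ i ∈ t, b.repr u i • A i x) (fun t => ?_) ?_
      · exact Finset.aestronglyMeasurable_fun_sum t fun i _ => (hA i).const_smul _
      · filter_upwards [hNb] with x hx
        have h := (b.hasSum_repr u).mapL ((L x).extendOfNorm U)
        simp only [map_smul] at h
        simp only [← hx]
        exact h
    -- A range operator needs genuine measurability; completeness of `μ` supplies it from
    -- measurability up to a null set.
    exact ((h.const_inner (𝕜 := ℂ) (c := v)).aemeasurable).nullMeasurable.measurable_of_complete
  let R : RangeOperator μ (RangeFunction.full X H) (RangeFunction.full X H') :=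
    ofLinear N (fun _ _ _ => RangeFunction.mem_full _ _) ⟨_, hN⟩ fun u v => by
      simp only [RangeFunction.full_starProjection]
      exact hNm u v
  refine ⟨R, eq_of_apply_weighted_eq hw R.extL_mulOp hS b fun i => Lp.ext ?_⟩
  filter_upwards [hw, hNb, weighted_coeFn w (b i), R.extL_coeFn (weighted w (b i))]
    with x h0 h1 h2 h3
  rw [h3, ofLinear_ext, RangeFunction.full_starProjection, h2, map_smul, h1, smul_smul,
    mul_inv_cancel₀ h0, one_smul]

end RangeOperator

end Decomposition
-- Range operators and MI operators
section Operators

variable {X : Type u} [MeasurableSpace X] {μ : Measure X}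
variable {H : Type v} [NormedAddCommGroup H] [InnerProductSpace ℂ H] [CompleteSpace H]
variable {H' : Type v'} [NormedAddCommGroup H'] [InnerProductSpace ℂ H'] [CompleteSpace H']
variable {H'' : Type w} [NormedAddCommGroup H''] [InnerProductSpace ℂ H''] [CompleteSpace H'']

/-- The definition pairs with the conjugate of `φ`, so it is applied to the conjugates of `h₁` and
`h₂`. -/
theorem IsDeterminingSet.ae_eq {D : Set (Lp ℂ ∞ μ)} (hD : IsDeterminingSet D) {h₁ h₂ : X → ℂ}
    (hi₁ : Integrable h₁ μ) (hi₂ : Integrable h₂ μ)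
    (h : ∀ φ ∈ D, ∫ x, φ x * h₁ x ∂μ = ∫ x, φ x * h₂ x ∂μ) : h₁ =ᵐ[μ] h₂ := by
  have hc : ∀ {k : X → ℂ}, Integrable k μ → Integrable (fun x => (starRingEnd ℂ) (k x)) μ :=
    fun hk => Complex.conjCLE.toContinuousLinearMap.integrable_comp hk
  have hint : ∀ {k : X → ℂ} (hk : Integrable k μ) (φ : Lp ℂ ∞ μ),
      ∫ x, (hc hk).toL1 _ x * (starRingEnd ℂ) (φ x) ∂μ =
        (starRingEnd ℂ) (∫ x, φ x * k x ∂μ) := by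
    intro k hk φ
    rw [← integral_conj]
    refine integral_congr_ae ?_
    filter_upwards [(hc hk).coeFn_toL1] with x hx
    rw [hx, map_mul, mul_comm]
  have heq : (hc hi₁).toL1 _ = (hc hi₂).toL1 _ := by
    by_contra hne
    obtain ⟨φ, hφ, hφ'⟩ := hD _ _ hne
    exact hφ' (by rw [hint hi₁, hint hi₂, h φ hφ])
  filter_upwards [(Integrable.toL1_eq_toL1_iff _ _ _ _).1 heq] with x hx
  exact (starRingEnd ℂ).injective hx

/-- An operator that commutes with the multiplications by the elements of a determining set
commutes with all multiplications. -/
theorem IsDeterminingSet.apply_mulOp {D : Set (Lp ℂ ∞ μ)} (hD : IsDeterminingSet D)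
    {S : Lp H 2 μ →L[ℂ] Lp H' 2 μ} (hS : ∀ φ ∈ D, ∀ f, S (mulOp φ f) = mulOp φ (S f))
    (φ : Lp ℂ ∞ μ) (f : Lp H 2 μ) : S (mulOp φ f) = mulOp φ (S f) := by
  refine ext_inner_left ℂ fun g => ?_
  -- Passing to the adjoint turns commutation with `M_ψ` into equality of the integrals of `ψ`
  -- against two fixed `L¹` functions.
  have h : (fun x => inner ℂ (S.adjoint g x) (f x)) =ᵐ[μ] fun x => inner ℂ (g x) (S f x) := by
    refine hD.ae_eq (L2.integrable_inner _ _) (L2.integrable_inner _ _) fun ψ hψ => ?_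
    rw [← inner_mulOp_right, ← inner_mulOp_right, ContinuousLinearMap.adjoint_inner_left, hS ψ hψ]
  rw [← ContinuousLinearMap.adjoint_inner_left, inner_mulOp_right, inner_mulOp_right]
  refine integral_congr_ae ?_
  filter_upwards [h] with x hx
  rw [hx]

namespace RangeOperator

variable {J : RangeFunction X H} {J' : RangeFunction X H'}

theorem ext_starProjection (R : RangeOperator μ J J') (x : X) (u : H) :
    R.ext x ((J.fiber x).starProjection u) = R.ext x u := by
  rw [R.ext_apply_of_mem (Submodule.starProjection_apply_mem (J.fiber x) u)]
  rfl

variable [TopologicalSpace.SeparableSpace H]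

/-- The extension of an operator `V_J → V_{J'}` by zero on the orthogonal complement of `V_J`. -/
noncomputable def extendByProj (T : (J.miSpace μ).toSubmodule →L[ℂ] (J'.miSpace μ).toSubmodule) :
    Lp H 2 μ →L[ℂ] Lp H' 2 μ :=
  (J'.miSpace μ).toSubmodule.subtypeL ∘L T ∘L
    (proj μ J).extL.codRestrict (J.miSpace μ).toSubmodule fun f => (proj μ J).extL_mem f

theorem extendByProj_apply_coe (T : (J.miSpace μ).toSubmodule →L[ℂ] (J'.miSpace μ).toSubmodule)
    (f : (J.miSpace μ).toSubmodule) : extendByProj T f = T f := by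
  have h : (⟨(proj μ J).extL f, (proj μ J).extL_mem f⟩ : (J.miSpace μ).toSubmodule) = f :=
    Subtype.ext (proj_extL_eq_self f.2)
  exact congrArg (fun g => (T g : Lp H' 2 μ)) h

/-- The projection onto `V_J` is fibrewise, hence commutes with `M_φ`. This moves questions about
`T` to the full `L²` spaces, where adjoints and `exists_extL_eq` apply. -/
theorem commutesWithMul_iff {T : (J.miSpace μ).toSubmodule →L[ℂ] (J'.miSpace μ).toSubmodule}
    {φ : Lp ℂ ∞ μ} : CommutesWithMul T φ ↔
      ∀ f, extendByProj T (mulOp φ f) = mulOp φ (extendByProj T f) := by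
  refine ⟨fun h f => ?_, fun h => ContinuousLinearMap.ext fun f => Subtype.ext ?_⟩
  · have h1 : (⟨(proj μ J).extL (mulOp φ f), (proj μ J).extL_mem _⟩ :
        (J.miSpace μ).toSubmodule) =
          (J.miSpace μ).mul φ ⟨(proj μ J).extL f, (proj μ J).extL_mem f⟩ :=
      Subtype.ext ((proj μ J).extL_mulOp φ f)
    have h2 := congrArg (fun A => ((A ⟨(proj μ J).extL f, (proj μ J).extL_mem f⟩ :
      (J'.miSpace μ).toSubmodule) : Lp H' 2 μ)) h
    exact (congrArg (fun g => (T g : Lp H' 2 μ)) h1).trans h2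
  · have h1 := h f
    rw [extendByProj_apply_coe] at h1
    exact (extendByProj_apply_coe T ((J.miSpace μ).mul φ f)).symm.trans h1

variable [TopologicalSpace.SeparableSpace H']

theorem extL_comp [μ.IsComplete] [TopologicalSpace.SeparableSpace H'']
    {J₁ : RangeFunction X H'} {J₂ : RangeFunction X H''}
    (S : RangeOperator μ J₁ J₂) (R : RangeOperator μ J J') (f : Lp H 2 μ) :
    (S.comp R).extL f = S.extL (R.extL f) := by
  apply Lp.ext
  filter_upwards [R.extL_coeFn f, S.extL_coeFn (R.extL f), (S.comp R).extL_coeFn f] with x h1 h2 h3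
  rw [h3, h2, h1, comp_ext]

theorem extL_proj (R : RangeOperator μ J J') (f : Lp H 2 μ) :
    R.extL ((proj μ J).extL f) = R.extL f := by
  apply Lp.ext
  filter_upwards [R.extL_coeFn f, R.extL_coeFn ((proj μ J).extL f), (proj μ J).extL_coeFn f]
    with x h1 h2 h3
  rw [h2, h3, h1, proj_ext, ext_starProjection]

theorem incl_extL (f : Lp H 2 μ) : (incl μ J).extL f = (proj μ J).extL f := by
  apply Lp.ext
  filter_upwards [(incl μ J).extL_coeFn f, (proj μ J).extL_coeFn f] with x h1 h2
  rw [h1, h2, incl_ext, proj_ext]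

/-- The fibres `N(x)` of the extension of `T` act on all of `H`; they are restricted to `J(x)` and
followed by the projection onto `J'(x)`, which changes nothing because `T` takes values in `V_{J'}`.
-/
theorem exists_directIntegral_eq [SigmaFinite μ] [μ.IsComplete]
    {T : (J.miSpace μ).toSubmodule →L[ℂ] (J'.miSpace μ).toSubmodule} (hT : IsMIOperator T) :
    ∃ R : RangeOperator μ J J', T = R.directIntegral := by
  obtain ⟨N, hN⟩ := exists_extL_eq fun φ => commutesWithMul_iff.1 (hT φ)
  refine ⟨(proj μ J').comp (N.comp (incl μ J)),
    ContinuousLinearMap.ext fun f => Subtype.ext ?_⟩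
  refine Eq.trans ?_ (extL_comp (proj μ J') (N.comp (incl μ J)) f).symm
  rw [extL_comp, incl_extL, proj_extL_eq_self f.2, hN, extendByProj_apply_coe,
    proj_extL_eq_self (T f).2]

theorem tfae_isMIOperator [SigmaFinite μ] [μ.IsComplete]
    (T : (J.miSpace μ).toSubmodule →L[ℂ] (J'.miSpace μ).toSubmodule)
    {D : Set (Lp ℂ ∞ μ)} (hD : IsDeterminingSet D) :
    List.TFAE [IsMIOperator T, ∀ φ ∈ D, CommutesWithMul T φ,
      ∃ R : RangeOperator μ J J', T = R.directIntegral] := by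
  tfae_have 1 → 2 := fun h φ _ => h φ
  tfae_have 2 → 1 := fun h φ => commutesWithMul_iff.2
    (hD.apply_mulOp (fun ψ hψ => commutesWithMul_iff.1 (h ψ hψ)) φ)
  tfae_have 1 → 3 := exists_directIntegral_eq
  tfae_have 3 → 1 := by
    rintro ⟨R, rfl⟩
    exact R.directIntegral_isMIOperator
  tfae_finish

theorem toMIOperator_bijective [SigmaFinite μ] [μ.IsComplete] :
    Function.Bijective (toMIOperator (μ := μ) (J := J) (J' := J')) := by
  refine ⟨fun a b => ?_, fun T => ?_⟩
  · induction a using Quotient.inductionOn with | _ R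
    induction b using Quotient.inductionOn with | _ S
    intro h
    have h' : R.directIntegral = S.directIntegral := congrArg Subtype.val h
    refine Quotient.sound ((ae_ext_eq_of_extL_eq fun f => ?_).mono fun x => op_eq_of_ext_eq)
    -- `extL` factors through the projection onto `V_J`, so equality on `V_J` gives equality on all
    -- of `L²(X; H)`.
    rw [← R.extL_proj, ← S.extL_proj]
    exact congrArg (fun A => ((A ⟨(proj μ J).extL f, (proj μ J).extL_mem f⟩ :
      (J'.miSpace μ).toSubmodule) : Lp H' 2 μ)) h'
  · obtain ⟨R, hR⟩ := exists_directIntegral_eq T.2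
    exact ⟨Quotient.mk _ R, Subtype.ext hR.symm⟩

end RangeOperator

end Operators
-- MI spaces and range functions
section Objects

variable {X : Type u} [MeasurableSpace X] {μ : Measure X}
variable {H : Type v} [NormedAddCommGroup H] [InnerProductSpace ℂ H]

/-- For `g` in `V`, the vector `f - P_V f` is orthogonal to every `M_ψ g`, hence pointwise
orthogonal to `g`; multiplying it by `φ` keeps it orthogonal to `V`. -/
theorem MISpace.starProjection_mulOp (V : MISpace μ H) [V.toSubmodule.HasOrthogonalProjection]
    (φ : Lp ℂ ∞ μ) (f : Lp H 2 μ) :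
    V.toSubmodule.starProjection (mulOp φ f) = mulOp φ (V.toSubmodule.starProjection f) := by
  refine Submodule.eq_starProjection_of_mem_of_inner_eq_zero
    (V.mulOp_mem φ _ (Submodule.starProjection_apply_mem _ f)) fun g hg => ?_
  have h : ∀ᵐ x ∂μ, inner ℂ ((f - V.toSubmodule.starProjection f : Lp H 2 μ) x) (g x) = 0 :=
    ae_inner_eq_zero fun ψ =>
      Submodule.starProjection_inner_eq_zero f _ (V.mulOp_mem ψ g hg)
  rw [← map_sub, L2.inner_def]
  refine integral_eq_zero_of_ae ?_
  filter_upwards [h, mulOp_coeFn φ (f - V.toSubmodule.starProjection f)] with x h1 h2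
  rw [h2, inner_smul_left, h1, mul_zero]
  rfl

/-- A linear map `N` whose range is orthogonal to the range of `1 - N` is the orthogonal projection
onto the subspace of its fixed vectors. -/
theorem starProjection_apply_of_forall_inner_eq_zero {K : Submodule ℂ H} [K.HasOrthogonalProjection]
    {N : H →ₗ[ℂ] H}
    (hK : ∀ u, u ∈ K ↔ N u = u) (h : ∀ u v, inner ℂ (u - N u) (N v) = 0) (u : H) :
    K.starProjection u = N u := by
  refine Submodule.eq_starProjection_of_mem_of_inner_eq_zero ?_ fun v hv => ?_
  · rw [hK]
    -- This instance reads `‖N u - N (N u)‖² = 0`, so `N` is idempotent.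
    have h1 := h (N u) (u - N u)
    rw [map_sub] at h1
    rw [eq_comm, ← sub_eq_zero, ← inner_self_eq_zero (𝕜 := ℂ), h1]
  · rw [← (hK v).1 hv]
    exact h u v

variable [SigmaFinite μ] [CompleteSpace H] [TopologicalSpace.SeparableSpace H]

/-- The vector `x ↦ w(x) P_J(x) u` lies in `V_J`, hence in `V_{J'}`, and `w(x)` cancels. -/
theorem RangeFunction.ae_le_of_miSpace_le {J J' : RangeFunction X H}
    (h : (J.miSpace μ).toSubmodule ≤ (J'.miSpace μ).toSubmodule) :
    ∀ᵐ x ∂μ, J.fiber x ≤ J'.fiber x := by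
  obtain ⟨w, hw⟩ := exists_Lp_two_ae_ne_zero μ
  have h1 : ∀ᵐ x ∂μ, ∀ u : H, (J.fiber x).starProjection u ∈ J'.fiber x := by
    refine ae_forall_of_isClosed (Eventually.of_forall fun x => ?_) fun u => ?_
    · exact (J'.space x).isClosed.preimage (J.fiber x).starProjection.continuous
    · filter_upwards [hw, weighted_coeFn w u, (RangeOperator.proj μ J).extL_coeFn (weighted w u),
        RangeFunction.mem_miSpace.1 (h ((RangeOperator.proj μ J).extL_mem (weighted w u)))]
        with x h0 h1 h2 h3
      rw [h2, RangeOperator.proj_ext, h1, map_smul] at h3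
      exact ((J'.fiber x).smul_mem_iff h0).1 h3
  filter_upwards [h1] with x hx u hu
  have := hx u
  rwa [Submodule.starProjection_eq_self_iff.2 hu] at this

theorem RangeFunction.ae_eq_of_miSpace_eq {J J' : RangeFunction X H}
    (h : J.miSpace μ = J'.miSpace μ) : ∀ᵐ x ∂μ, J.space x = J'.space x := by
  filter_upwards [ae_le_of_miSpace_le (μ := μ) (J := J) (J' := J') (by rw [h]),
    ae_le_of_miSpace_le (μ := μ) (J := J') (J' := J) (by rw [h])] with x h1 h2
  exact ClosedSubmodule.toSubmodule_injective (le_antisymm h1 h2)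

/-- The fibres `N(x)` of `P_V` inherit `(1 - N) u ⊥ N v` a.e., so they are orthogonal projections;
`J(x)` is the space of fixed vectors of `N(x)`. -/
theorem MISpace.exists_miSpace_eq [μ.IsComplete] (V : MISpace μ H) :
    ∃ J : RangeFunction X H, J.miSpace μ = V := by
  have : CompleteSpace V.toSubmodule := V.isClosed'.completeSpace_coe
  obtain ⟨N, hN⟩ := RangeOperator.exists_extL_eq V.starProjection_mulOp
  obtain ⟨w, hw⟩ := exists_Lp_two_ae_ne_zero μ
  obtain ⟨C, hC⟩ := N.exists_ext_bound
  have horth : ∀ᵐ x ∂μ, ∀ p : H × H, inner ℂ (p.1 - N.ext x p.1) (N.ext x p.2) = 0 := by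
    refine ae_forall_of_isClosed ?_ fun p => ?_
    · filter_upwards [hC] with x hx
      have hc : Continuous (N.ext x) := ((N.ext x).mkContinuous C hx).continuous
      exact isClosed_eq (by fun_prop) continuous_const
    · have h : ∀ᵐ x ∂μ, inner ℂ ((weighted w p.1 - N.extL (weighted w p.1) : Lp H 2 μ) x)
          (N.extL (weighted w p.2) x) = 0 := by
        rw [hN]
        exact ae_inner_eq_zero fun ψ => Submodule.starProjection_inner_eq_zero _ _
          (V.mulOp_mem ψ _ (Submodule.starProjection_apply_mem _ _))
      filter_upwards [h, hw, weighted_coeFn w p.1, weighted_coeFn w p.2,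
        N.extL_coeFn (weighted w p.1), N.extL_coeFn (weighted w p.2),
        Lp.coeFn_sub (weighted w p.1) (N.extL (weighted w p.1))] with x h0 hw h1 h2 h3 h4 h5
      rw [h5, Pi.sub_apply, h3, h4, h1, h2, map_smul, map_smul, ← smul_sub, inner_smul_left,
        inner_smul_right] at h0
      exact (mul_eq_zero.1 ((mul_eq_zero.1 h0).resolve_left ((map_ne_zero _).2 hw))).resolve_left hw
  let good : X → Prop := fun x => Continuous (N.ext x) ∧
    ∀ u v, inner ℂ (u - N.ext x u) (N.ext x v) = 0
  have hgood : ∀ᵐ x ∂μ, good x := by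
    filter_upwards [hC, horth] with x h1 h2
    exact ⟨((N.ext x).mkContinuous C h1).continuous, fun u v => h2 (u, v)⟩
  classical
  -- Each fibre must be closed, even at the exceptional points, where `⊥` is chosen.
  let space : X → ClosedSubmodule ℂ H := fun x =>
    if h : good x then
      { toSubmodule := LinearMap.eqLocus (N.ext x) LinearMap.id
        isClosed' := isClosed_eq h.1 continuous_id }
    else ⊥
  have hspace : ∀ᵐ x ∂μ, ∀ u, u ∈ (space x).toSubmodule ↔ N.ext x u = u := by
    filter_upwards [hgood] with x hx u
    simp only [space, dif_pos hx]
    rfl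
  have hproj : ∀ᵐ x ∂μ, ∀ u, (space x).toSubmodule.starProjection u = N.ext x u := by
    filter_upwards [hgood, hspace] with x h1 h2
    exact starProjection_apply_of_forall_inner_eq_zero h2 h1.2
  let J : RangeFunction X H :=
    { space := space
      measurable_proj := fun u v => by
        have h1 : AEStronglyMeasurable (fun x => N.ext x u) μ :=
          N.aestronglyMeasurable_ext aestronglyMeasurable_const
        have h2 : AEStronglyMeasurable
            (fun x => inner ℂ v ((space x).toSubmodule.starProjection u)) μ :=
          (h1.const_inner (𝕜 := ℂ) (c := v)).congr (hproj.mono fun x hx => by simp only [hx])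
        exact h2.aemeasurable.nullMeasurable.measurable_of_complete }
  refine ⟨J, ?_⟩
  have hJ : (J.miSpace μ).toSubmodule = V.toSubmodule := by
    ext f
    -- Membership in `V` means `P_V f = f`, that is, `N(x) f(x) = f(x)` a.e.
    rw [← Submodule.starProjection_eq_self_iff (K := V.toSubmodule), ← hN,
      RangeFunction.mem_miSpace]
    refine ⟨fun h => Lp.ext ?_, fun h => ?_⟩
    · filter_upwards [h, hspace, N.extL_coeFn f] with x h1 h2 h3
      rw [h3]
      exact (h2 _).1 h1
    · filter_upwards [hspace, N.extL_coeFn f] with x h2 h3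
      rw [h] at h3
      exact (h2 _).2 h3.symm
  exact MISpace.ext congr(($hJ : Set (Lp H 2 μ)))

end Objects

/-! ### Isomorphism of categories -/

section Categories

/-- A fully faithful functor that is bijective on objects has a strict inverse. -/
theorem exists_strict_inverse {C : Type*} [Category* C] {D : Type*} [Category* D] (F : C ⥤ D)
    [F.Full] [F.Faithful] (hF : Function.Bijective F.obj) :
    ∃ G : D ⥤ C, F ⋙ G = 𝟭 C ∧ G ⋙ F = 𝟭 D := by
  let e := Equiv.ofBijective F.obj hF
  have h : ∀ d, F.obj (e.symm d) = d := e.apply_symm_apply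
  have h' : ∀ c, e.symm (F.obj c) = c := e.symm_apply_apply
  let G : D ⥤ C :=
    { obj := e.symm
      -- The equalities `F (G d) = d` are strict only on objects and not definitional, so `f` is
      -- transported along them before its preimage is taken.
      map := fun {d d'} f => F.preimage (eqToHom (h d) ≫ f ≫ eqToHom (h d').symm)
      map_id := fun d => F.map_injective (by simp)
      map_comp := fun f g => F.map_injective (by simp) }
  refine ⟨G, CategoryTheory.Functor.ext h' fun c c' f => F.map_injective ?_,
    CategoryTheory.Functor.ext h fun d d' f => ?_⟩
  · simp [G, eqToHom_map]
  · simp [G]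

variable {X : Type u} [MeasurableSpace X] {μ : Measure X} [SigmaFinite μ] [μ.IsComplete]

theorem functorF_obj_bijective : Function.Bijective (functorF.{u, w} μ).obj := by
  refine ⟨?_, ?_⟩
  · rintro ⟨K, a⟩ ⟨K', b⟩ h
    simp only [functorF, XMI.mk.injEq] at h
    -- `F` keeps the Hilbert space, so its type, norm and inner product are identified before the MI
    -- spaces can be compared.
    obtain ⟨rfl, h1, h2, h⟩ := h
    obtain rfl := eq_of_heq h1
    obtain rfl := eq_of_heq h2
    have h := eq_of_heq h
    induction a using Quotient.inductionOn with | _ J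
    induction b using Quotient.inductionOn with | _ J'
    have : Quotient.mk (RangeFunction.aeSetoid X μ K) J = Quotient.mk _ J' :=
      Quotient.sound (RangeFunction.ae_eq_of_miSpace_eq h)
    rw [this]
  · rintro ⟨K, V⟩
    obtain ⟨J, rfl⟩ := V.exists_miSpace_eq
    exact ⟨{ K := K, cls := Quotient.mk _ J }, rfl⟩

instance functorF_faithful : (functorF.{u, w} μ).Faithful where
  map_injective {A B} f g h := by
    induction f using Quotient.inductionOn with | _ R
    induction g using Quotient.inductionOn with | _ S
    have h' : R.toMIOperator.1 = S.toMIOperator.1 := congrArg Subtype.val h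
    refine Quotient.sound (RangeOperator.ae_ext_eq_of_extL_eq fun f => ?_)
    have hmem : (RangeOperator.proj μ R.dom).extL f ∈ A.miSpace.toSubmodule := by
      rw [A.miSpace_eq R.dom_mem]
      exact RangeOperator.extL_mem _ f
    -- The two representatives may have different domains, which agree a.e. and so have the same
    -- projection on `L²`.
    have hS : (RangeOperator.proj μ R.dom).extL f = (RangeOperator.proj μ S.dom).extL f := by
      apply Lp.ext
      filter_upwards [(RangeOperator.proj μ R.dom).extL_coeFn f,
        (RangeOperator.proj μ S.dom).extL_coeFn f, XRan.ae_eq_of_mem R.dom_mem S.dom_mem]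
        with x h1 h2 h3
      rw [h1, h2, RangeOperator.proj_ext, RangeOperator.proj_ext]
      simp only [RangeFunction.fiber, h3]
    rw [← R.op.extL_proj, ← S.op.extL_proj, ← hS]
    exact congrArg (fun T => ((T ⟨_, hmem⟩ : B.miSpace.toSubmodule) : Lp B.K 2 μ)) h'

instance functorF_full : (functorF.{u, w} μ).Full where
  map_surjective {A B} T := by
    obtain ⟨K, a⟩ := A
    obtain ⟨K', b⟩ := B
    induction a using Quotient.inductionOn with | _ J
    induction b using Quotient.inductionOn with | _ J'
    obtain ⟨R, hR⟩ := RangeOperator.exists_directIntegral_eq (J := J) (J' := J') T.2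
    exact ⟨Quotient.mk _ ⟨J, J', rfl, rfl, R⟩, Subtype.ext hR.symm⟩

end Categories
end MultInv

theorem mainTheorem1 {X : Type u} [MeasurableSpace X] (μ : Measure X) [SigmaFinite μ]
    [μ.IsComplete] [TopologicalSpace.SeparableSpace (Lp ℂ 2 μ)] :
    (∀ (H : Type v) [NormedAddCommGroup H] [InnerProductSpace ℂ H] [CompleteSpace H]
        [TopologicalSpace.SeparableSpace H]
        (H' : Type v') [NormedAddCommGroup H'] [InnerProductSpace ℂ H'] [CompleteSpace H']
        [TopologicalSpace.SeparableSpace H']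
        (J : RangeFunction X H) (J' : RangeFunction X H'),
      (∀ (T : (J.miSpace μ).toSubmodule →L[ℂ] (J'.miSpace μ).toSubmodule)
          (D : Set (Lp ℂ ∞ μ)), IsDeterminingSet D →
        List.TFAE
          [IsMIOperator T,
            ∀ φ ∈ D, CommutesWithMul T φ,
            ∃ R : RangeOperator μ J J', T = R.directIntegral]) ∧
      Function.Bijective (RangeOperator.toMIOperator (μ := μ) (J := J) (J' := J'))) ∧
    (∃ G : XMI.{u, w} μ ⥤ XRan.{u, w} μ,
      functorF.{u, w} μ ⋙ G = 𝟭 (XRan.{u, w} μ) ∧ G ⋙ functorF.{u, w} μ = 𝟭 (XMI.{u, w} μ)) :=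
  ⟨fun _ _ _ _ _ _ _ _ _ _ _ _ =>
    ⟨fun T _ hD => RangeOperator.tfae_isMIOperator T hD, RangeOperator.toMIOperator_bijective⟩,
    exists_strict_inverse _ functorF_obj_bijective⟩
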